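/- There are $m$ identical machines and $n$ jobs that arrive online in a sequence; job $j$ has a load vector $p_j\in[0,\infty)^d$, revealed on arrival, and must at once be assigned irrevocably to a machine by a deterministic algorithm. An assignment $f$ gives machine $i$ the load $\Lambda_i^f(k)=\sum_{j:f(j)=i}p_j(k)$ in dimension $k$; for $r\ge 1$ let $\|\Lambda^f(k)\|_r=\big(\sum_i\Lambda^f_i(k)^r\big)^{1/r}$ and $\mathrm{OPT}_r(k)=\min_f\|\Lambda^f(k)\|_r$. The algorithm knows $m$ and $d$ and, in accordance with the convention that each dimension is scaled in advance relative to its optimum, the total load $\sum_j p_j(k)=\mathrm{OPT}_1(k)$ of each dimension $k$; it does not know $n$ or the future jobs. (Upper bound.) There is an absolute constant $C>0$ such that for all $d\ge 3$ and $m\ge 1$ there is such an online algorithm whose assignment satisfies, on every job sequence, simultaneously for every dimension $k$ and every real $r\ge 1$, $$\|\Lambda(k)\|_r\le C\Big(\frac{\log d}{\log\log d}\Big)^{\frac{r-1}{r}}\mathrm{OPT}_r(k).$$ (Lower bound.) There is an absolute constant $c>0$ such that for every $d\ge 3$ and every real $r\ge 1$ there is an $m\ge 1$ such that for every deterministic online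 algorithm on $m$ machines in dimension $d$, even one that knows in advance all the values $\mathrm{OPT}_{s}(k)$, $k\in[d]$, $s\ge 1$, there are a job sequence, a single offline assignment $g$ of it with $\|\Lambda^g(k')\|_r>0$ for all $k'$, and a dimension $k$ for which the load $\Lambda(k)$ produced by the algorithm satisfies $$\|\Lambda(k)\|_r\ge c\Big(\frac{\log d}{\log\log d}\Big)^{\frac{r-1}{r}}\max_{k'\in[d]}\|\Lambda^g(k')\|_r .$$ -/

import Mathlib

open scoped NNReal

noncomputable section

namespace VectorScheduling

/-- A job on identical machines: its load in each of the `d` dimensions. -/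
abbrev Job (d : ℕ) := Fin d → ℝ≥0

/-- The load vector of the `m` machines in dimension `k`, when the jobs `p 0, …, p (n-1)` are
assigned to machines by `f`. -/
def load {d m n : ℕ} (p : Fin n → Job d) (f : Fin n → Fin m) (k : Fin d) : Fin m → ℝ≥0 :=
  fun i => ∑ j with f j = i, p j k

/-- The `L_r` norm of a vector of machine loads. -/
def lrNorm {m : ℕ} (r : ℝ) (x : Fin m → ℝ≥0) : ℝ≥0 :=
  (∑ i, x i ^ r) ^ (1 / r)

/-- The optimal (offline) `L_r` norm in dimension `k`, over all assignments to `m` machines. -/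
def optNorm {d n : ℕ} (m : ℕ) (p : Fin n → Job d) (k : Fin d) (r : ℝ) : ℝ≥0 :=
  ⨅ f : Fin n → Fin m, lrNorm r (load p f k)

/-- The total load of all jobs in each dimension. -/
def totalLoad {d n : ℕ} (p : Fin n → Job d) : Fin d → ℝ≥0 :=
  fun k => ∑ j, p j k

/-- The optimal norms of an instance, for every dimension and every `r ≥ 1`. -/
def optTable {d n : ℕ} (m : ℕ) (p : Fin n → Job d) : Fin d → Set.Ici (1 : ℝ) → ℝ≥0 :=
  fun k r => optNorm m p k r

/-- A deterministic online algorithm for `m` machines and `d` dimensions. It has some advance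
information of type `I` about the scale of the instance. The machine for the arriving job is a
function of this information, the list of the earlier jobs, and the arriving job. -/
abbrev OnlineAlgorithm (I : Type) (d m : ℕ) := I → List (Job d) → Job d → Fin m

/-- The assignment that the algorithm `A` produces on the job sequence `p`. -/
def OnlineAlgorithm.run {I : Type} {d m n : ℕ} (A : OnlineAlgorithm I d m) (info : I)
    (p : Fin n → Job d) : Fin n → Fin m :=
  fun j => A info (List.ofFn fun i : Fin j => p (Fin.castLE j.isLt.le i)) (p j)

/-- The quantity `log d / log log d`. -/
def logRatio (d : ℕ) : ℝ := Real.log d / Real.log (Real.log d)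

end VectorScheduling

end

/-!
Upper bound. Fix a dimension and let `a` be the average machine load, which is known in advance.
Call a job small if its load is at most `a`, and big otherwise. If every machine receives small jobs
of total load at most `M * a` and at most `M` big jobs, then by convexity the sum of the `r`-th
powers of the loads is at most about `M ^ (r - 1)` times `m * a ^ r` plus the sum of the `r`-th
powers of the jobs, and both terms are lower bounds for the `r`-th power of the optimum, for all `r`
simultaneously (`lrNorm_load_le`). So it suffices to balance `2 d` dimensions, the scaled small loads
and the numbers of big jobs, with loads in `[0, 1]` and totals at most `m`, such that all machine
loads are `O(log d / log log d)`.

If each job went to a random machine, the load that a job finds there would exceed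
`τ = O(log d / log log d)` in some dimension with probability at most `1 / poly d`, so the jobs that
find such an overflow have total volume at most `m`. They can be redirected and balanced greedily
by volume. The random choice is replaced by the choice of a machine that does not increase a
potential, a pessimistic estimator of the overflow volume (`exists_spreadPotential_le`). As only the
overflow volume is estimated, and not the probability that some machine overflows, the bound does
not depend on `m`. The outcome is `exists_online_spread`.

Lower bound. The jobs are vertices of a graph and the machines are colours. The adversary reveals
the graph vertex by vertex and colours each vertex after the algorithm has done so; its own colouring
must be proper. For every colour `i` of the algorithm it maintains a clique `Q i` with this colour.
It leaves two of its own colours open, both occurring in equally many cliques and never in the same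
one, joins the new vertex to the vertices of the cliques of all other colours, and gives the vertex
the open colour that is missing in the clique that it joins. The sum of the squared numbers of
occurrences of the colours increases with each move, so after polynomially many moves some clique
reaches size `q` (`exists_monochromatic_clique`). There is one dimension for every sequence of `q`
vertices, and a vertex has load `1` in a dimension if it belongs to its sequence and is joined to all
earlier members. Padding jobs on reserved machines make the total load equal to `q` in every
dimension, so the optimal norms are fixed in advance, and the algorithm has load `q` on one machine
where the proper colouring has `q` machines of load `1`. The number of dimensions is `q ^ O(q)`,
which permits `q` of order `log d / log log d`.
-/

namespace VectorScheduling

/-! ### The potential of the tentative assignment -/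

/-- The machine loads `x` after a job with load vector `w` has been put on machine `i`. -/
def addLoad {ι : Type*} {m : ℕ} (x : Fin m → ι → ℝ) (i : Fin m) (w : ι → ℝ) : Fin m → ι → ℝ :=
  fun i' k => x i' k + if i' = i then w k else 0

/-- An upper estimate for the sum, over the remaining jobs and the dimensions, of the job's volume
times `α ^ y`, where `y` is the load that the job finds on its machine, when the tentative loads are
`x` and every remaining job goes to a uniformly random machine. If the job finds more than `τ - 1`
in some dimension, it contributes at least `α ^ (τ - 1)` times its volume. In dimension `k` the
remaining job volume (summed over the dimensions, each with total load at most `m`) is multiplied by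
the current mean of `α ^ x i k` over the machines, and by the factor by which the remaining load of
dimension `k` can still increase that mean. -/
noncomputable def spreadPotential {ι : Type*} [Fintype ι] {m : ℕ} (α : ℝ)
    (x : Fin m → ι → ℝ) : ℝ :=
  ∑ k, (Fintype.card ι * m - ∑ k', ∑ i, x i k') / m * (∑ i, α ^ x i k) *
    Real.exp ((α - 1) * (1 - (∑ i, x i k) / m))

theorem sum_addLoad {ι : Type*} {m : ℕ} (x : Fin m → ι → ℝ) (i : Fin m) (w : ι → ℝ) (k : ι) :
    ∑ i', addLoad x i w i' k = ∑ i', x i' k + w k := by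
  simp [addLoad, Finset.sum_add_distrib]

theorem sum_rpow_addLoad_le {ι : Type*} {m : ℕ} {α : ℝ} (hα : 1 ≤ α) (x : Fin m → ι → ℝ)
    (i : Fin m) {w : ι → ℝ} {k : ι} (hw : 0 ≤ w k) (hw' : w k ≤ 1) :
    ∑ i', α ^ addLoad x i w i' k ≤
      ∑ i', α ^ x i' k + α ^ x i k * ((α - 1) * w k) := by
  -- Bernoulli's inequality, with the exponent in the unit interval
  have bern : α ^ w k ≤ 1 + (α - 1) * w k := by
    have := rpow_one_add_le_one_add_mul_self (s := α - 1) (by linarith) hw hw'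
    rw [add_sub_cancel] at this
    linarith
  have h : ∀ i', α ^ addLoad x i w i' k ≤
      α ^ x i' k + if i' = i then α ^ x i k * ((α - 1) * w k) else 0 := by
    intro i'
    by_cases h : i' = i
    · subst h
      have h0 : 0 < α ^ x i' k := Real.rpow_pos_of_pos (by linarith) _
      simp only [addLoad, if_true]
      rw [Real.rpow_add (by linarith)]
      nlinarith
    · simp [addLoad, h]
  calc _ ≤ _ := Finset.sum_le_sum fun i' _ => h i'
    _ = _ := by simp [Finset.sum_add_distrib]

theorem exists_spreadPotential_le {ι : Type*} [Fintype ι] {m : ℕ} (hm : 1 ≤ m) {α : ℝ}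
    (hα : 1 ≤ α) (x : Fin m → ι → ℝ) {w : ι → ℝ} (hw : ∀ k, 0 ≤ w k) (hw' : ∀ k, w k ≤ 1)
    (hx : ∀ k, ∑ i, x i k + w k ≤ m) :
    ∃ i, (∑ k, w k) * ∑ k, α ^ x i k + spreadPotential α (addLoad x i w) ≤
      spreadPotential α x := by
  have hm0 : (0 : ℝ) < m := by exact_mod_cast hm
  set v := ∑ k, w k with hv
  set R : ℝ := Fintype.card ι * m - ∑ k', ∑ i, x i k' with hR
  set F : ι → ℝ := fun k => ∑ i, α ^ x i k with hF
  set E : ι → ℝ := fun k => Real.exp ((α - 1) * (1 - (∑ i, x i k) / m)) with hE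
  have hv0 : 0 ≤ v := Finset.sum_nonneg fun k _ => hw k
  have hvR : v ≤ R := by
    have : ∑ k, (∑ i, x i k + w k) ≤ ∑ _k : ι, (m : ℝ) := Finset.sum_le_sum fun k _ => hx k
    simp only [Finset.sum_add_distrib, Finset.sum_const, Finset.card_univ, nsmul_eq_mul] at this
    linarith
  have hF0 : ∀ k, 0 ≤ F k := fun k =>
    Finset.sum_nonneg fun i _ => Real.rpow_nonneg (by linarith) _
  have hE1 : ∀ k, 1 ≤ E k := by
    intro k
    apply Real.one_le_exp
    have : (∑ i, x i k) / m ≤ 1 := by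
      rw [div_le_one hm0]; linarith [hx k, hw k]
    nlinarith
  -- the potential after the move, in terms of the quantities before it; `E k` loses the factor
  -- that outweighs the expected growth of `F k`, by `1 + u ≤ exp u`
  have hstep : ∀ i, spreadPotential α (addLoad x i w) ≤
      ∑ k, (R - v) / m * (F k + α ^ x i k * ((α - 1) * w k)) *
        (E k * Real.exp (-((α - 1) * w k / m))) := by
    intro i
    unfold spreadPotential
    simp only [sum_addLoad, Finset.sum_add_distrib]
    refine Finset.sum_le_sum fun k _ => ?_
    have e1 : Real.exp ((α - 1) * (1 - (∑ i, x i k + w k) / m)) =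
        E k * Real.exp (-((α - 1) * w k / m)) := by
      rw [hE, ← Real.exp_add]; congr 1; ring
    rw [e1]
    have e2 := sum_rpow_addLoad_le hα x i (hw k) (hw' k)
    have e3 : (Fintype.card ι * m - (∑ k', ∑ i, x i k' + ∑ k, w k)) / m = (R - v) / m := by
      rw [hR, hv]; ring
    rw [e3]
    have : 0 ≤ (R - v) / m := div_nonneg (by linarith) hm0.le
    have : 0 ≤ E k := by linarith [hE1 k]
    gcongr
  have hmain : ∑ i, (v * ∑ k, α ^ x i k + spreadPotential α (addLoad x i w)) ≤
      ∑ _i : Fin m, spreadPotential α x := by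
    calc _ ≤ ∑ i, (v * ∑ k, α ^ x i k + ∑ k, (R - v) / m *
          (F k + α ^ x i k * ((α - 1) * w k)) * (E k * Real.exp (-((α - 1) * w k / m)))) :=
          Finset.sum_le_sum fun i _ => by linarith [hstep i]
      _ = ∑ k, (v * F k + (R - v) / m * (m * F k + F k * ((α - 1) * w k)) *
            (E k * Real.exp (-((α - 1) * w k / m)))) := by
          simp only [Finset.mul_sum, ← Finset.sum_add_distrib]
          rw [Finset.sum_comm]
          refine Finset.sum_congr rfl fun k _ => ?_
          rw [Finset.sum_add_distrib, ← Finset.mul_sum, ← Finset.sum_mul, ← Finset.mul_sum,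
            Finset.sum_add_distrib, ← Finset.sum_mul]
          simp [hF]
      _ ≤ ∑ k, R * F k * E k := by
          refine Finset.sum_le_sum fun k _ => ?_
          set u := (α - 1) * w k / m with hu
          have h1 : (R - v) / m * (m * F k + F k * ((α - 1) * w k)) = (R - v) * F k * (u + 1) := by
            rw [hu]; field_simp; ring
          have h2 : (u + 1) * Real.exp (-u) ≤ 1 := by
            rw [Real.exp_neg, ← div_eq_mul_inv, div_le_one (Real.exp_pos _)]
            exact Real.add_one_le_exp u
          rw [h1]
          have h3 : 0 ≤ (R - v) * F k * E k :=
            mul_nonneg (mul_nonneg (by linarith) (hF0 k)) (by linarith [hE1 k])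
          have h4 : v * F k ≤ v * F k * E k :=
            le_mul_of_one_le_right (mul_nonneg hv0 (hF0 k)) (hE1 k)
          nlinarith [mul_le_mul_of_nonneg_left h2 h3]
      _ = _ := by
          simp only [Finset.sum_const, Finset.card_univ, Fintype.card_fin, nsmul_eq_mul]
          unfold spreadPotential
          rw [Finset.mul_sum]
          refine Finset.sum_congr rfl fun k _ => ?_
          simp only [hF, hE, hR]
          field_simp
  have : Nonempty (Fin m) := ⟨⟨0, hm⟩⟩
  obtain ⟨i, -, hi⟩ := Finset.exists_le_of_sum_le Finset.univ_nonempty hmain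
  exact ⟨i, hi⟩

theorem spreadPotential_nonneg {ι : Type*} [Fintype ι] {m : ℕ} {α : ℝ} (hα : 1 ≤ α)
    {x : Fin m → ι → ℝ} (hx : ∀ k, ∑ i, x i k ≤ m) : 0 ≤ spreadPotential α x := by
  have h : ∑ k, ∑ i, x i k ≤ Fintype.card ι * m := by
    calc _ ≤ ∑ _k : ι, (m : ℝ) := Finset.sum_le_sum fun k _ => hx k
      _ = _ := by simp
  refine Finset.sum_nonneg fun k _ => mul_nonneg (mul_nonneg (div_nonneg (by linarith) (by simp)) ?_)
    (Real.exp_pos _).le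
  exact Finset.sum_nonneg fun i _ => Real.rpow_nonneg (by linarith) _

theorem spreadPotential_zero (ι : Type*) [Fintype ι] {m : ℕ} (hm : 1 ≤ m) (α : ℝ) :
    spreadPotential α (0 : Fin m → ι → ℝ) = (Fintype.card ι : ℝ) ^ 2 * Real.exp (α - 1) * m := by
  have hm0 : (m : ℝ) ≠ 0 := by positivity
  simp [spreadPotential]
  field_simp

/-! ### Balancing loads in the unit interval online -/

/-- The state of the online algorithm. -/
structure SpreadState (ι : Type*) (m : ℕ) where
  /-- The loads that the tentative choices for all jobs so far would give. -/
  tent : Fin m → ι → ℝ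
  /-- The scalar size that the redirected jobs have put on each machine. -/
  spill : Fin m → ℝ

namespace SpreadState

variable {ι : Type*} [Fintype ι] {m : ℕ} [NeZero m]

/-- The tentative machine of a job: the cost `v * ∑ k, α ^ x i k` of the job, `v` being its volume,
and the new potential are together at most the old potential. By `exists_spreadPotential_le` such a
machine exists as long as no dimension exceeds its total. -/
noncomputable def tentChoice (α : ℝ) (s : SpreadState ι m) (w : ι → ℝ) : Fin m :=
  Classical.epsilon fun i => (∑ k, w k) * ∑ k, α ^ s.tent i k +
    spreadPotential α (addLoad s.tent i w) ≤ spreadPotential α s.tent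

/-- A machine with the least spill. -/
noncomputable def leastSpill (s : SpreadState ι m) : Fin m :=
  Classical.epsilon fun i => ∀ i', s.spill i ≤ s.spill i'

/-- The tentative machine of the job `w` is already loaded beyond `τ - 1` in some dimension, so that
`w` has to be redirected. -/
def Overflows (α τ : ℝ) (s : SpreadState ι m) (w : ι → ℝ) : Prop :=
  ∃ k, τ - 1 < s.tent (s.tentChoice α w) k

open Classical in
/-- The machine that receives the job `w`. -/
noncomputable def choice (α τ : ℝ) (s : SpreadState ι m) (w : ι → ℝ) : Fin m :=
  if s.Overflows α τ w then s.leastSpill else s.tentChoice α w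

open Classical in
/-- The state after the job `w`. The tentative load also counts redirected jobs, and a redirected
job counts in the spill with its volume, cut off at `1`; this size dominates its load in every
dimension. -/
noncomputable def next (α τ : ℝ) (s : SpreadState ι m) (w : ι → ℝ) : SpreadState ι m where
  tent := addLoad s.tent (s.tentChoice α w) w
  spill i := s.spill i + if s.Overflows α τ w ∧ i = s.leastSpill then min 1 (∑ k, w k) else 0

/-- What is maintained when `s` is the state and `y` are the actual machine loads: the jobs that
stay on their tentative machine contribute at most the tentative load and at most `τ`, the
redirected ones at most the spill. The potential pays for the spill, which keeps its total at most
`m`. -/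
structure Invariant (α τ : ℝ) (s : SpreadState ι m) (y : Fin m → ι → ℝ) : Prop where
  le_tent : ∀ i k, y i k ≤ s.spill i + s.tent i k
  le_threshold : ∀ i k, y i k ≤ s.spill i + τ
  spill_le : ∀ i, s.spill i ≤ 2
  potential_le : α ^ (τ - 1) * ∑ i, s.spill i + spreadPotential α s.tent ≤
    (Fintype.card ι : ℝ) ^ 2 * Real.exp (α - 1) * m

theorem leastSpill_spec {κ : Type*} (s : SpreadState κ m) (i' : Fin m) :
    s.spill s.leastSpill ≤ s.spill i' := by
  have h : ∃ i, ∀ i', s.spill i ≤ s.spill i' := Finite.exists_min s.spill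
  exact Classical.epsilon_spec h i'

theorem Invariant.next {α τ : ℝ} (hα : 1 ≤ α)
    (hτ : (Fintype.card ι : ℝ) ^ 2 * Real.exp (α - 1) ≤ α ^ (τ - 1))
    {s : SpreadState ι m} {y : Fin m → ι → ℝ} (h : s.Invariant α τ y) {w : ι → ℝ}
    (hw : ∀ k, 0 ≤ w k) (hw' : ∀ k, w k ≤ 1) (hs : ∀ k, ∑ i, s.tent i k + w k ≤ m) :
    (s.next α τ w).Invariant α τ (addLoad y (s.choice α τ w) w) := by
  have hm : 1 ≤ m := Nat.one_le_iff_ne_zero.2 (NeZero.ne m)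
  have hm0 : (0 : ℝ) < m := by exact_mod_cast hm
  have hchoice := Classical.epsilon_spec (exists_spreadPotential_le hm hα s.tent hw hw' hs)
  change (∑ k, w k) * ∑ k, α ^ s.tent (s.tentChoice α w) k +
    spreadPotential α (addLoad s.tent (s.tentChoice α w) w) ≤ spreadPotential α s.tent at hchoice
  have hpow : 0 < α ^ (τ - 1) := Real.rpow_pos_of_pos (by linarith) _
  have hv : 0 ≤ ∑ k, w k := Finset.sum_nonneg fun k _ => hw k
  have hα0 : ∀ i k, 0 ≤ α ^ s.tent i k := fun i k => Real.rpow_nonneg (by linarith) _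
  have hq : ∀ k, w k ≤ min 1 (∑ k, w k) := fun k =>
    le_min (hw' k) (Finset.single_le_sum (fun k _ => hw k) (Finset.mem_univ k))
  have hq0 : 0 ≤ min 1 (∑ k, w k) := le_min zero_le_one hv
  have hmono : ∀ i k, s.tent i k ≤ addLoad s.tent (s.tentChoice α w) w i k := by
    intro i k
    unfold addLoad
    split_ifs
    · linarith [hw k]
    · linarith
  by_cases ho : s.Overflows α τ w
  · -- the total spill is at most `m`, so some machine has spill at most `1`
    have hleast : s.spill s.leastSpill ≤ 1 := by
      have h1 : ∑ _i : Fin m, s.spill s.leastSpill ≤ ∑ i, s.spill i :=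
        Finset.sum_le_sum fun i _ => s.leastSpill_spec i
      have h2 : 0 ≤ spreadPotential α s.tent :=
        spreadPotential_nonneg hα fun k => by linarith [hs k, hw k]
      have h3 := h.potential_le
      simp only [Finset.sum_const, Finset.card_univ, Fintype.card_fin, nsmul_eq_mul] at h1
      have h4 : α ^ (τ - 1) * (m * s.spill s.leastSpill) ≤ α ^ (τ - 1) * m := by
        have := mul_le_mul_of_nonneg_left h1 hpow.le
        have := mul_le_mul_of_nonneg_right hτ hm0.le
        linarith
      have h5 := le_of_mul_le_mul_left h4 hpow
      exact le_of_mul_le_mul_left (by linarith) hm0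
    obtain ⟨k₀, hk₀⟩ := id ho
    have hcost : α ^ (τ - 1) * min 1 (∑ k, w k) ≤
        (∑ k, w k) * ∑ k, α ^ s.tent (s.tentChoice α w) k := by
      have h1 : α ^ (τ - 1) ≤ ∑ k, α ^ s.tent (s.tentChoice α w) k :=
        (Real.rpow_le_rpow_of_exponent_le hα hk₀.le).trans
          (Finset.single_le_sum (f := fun k => α ^ s.tent (s.tentChoice α w) k)
            (fun k _ => hα0 _ k) (Finset.mem_univ k₀))
      rw [mul_comm]
      exact mul_le_mul (min_le_right _ _) h1 hpow.le hv
    refine ⟨fun i k => ?_, fun i k => ?_, fun i => ?_, ?_⟩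
    · have h1 := h.le_tent i k
      have h2 := hmono i k
      simp only [SpreadState.next, choice, ho, if_true, true_and] at h2 ⊢
      rw [addLoad]
      split_ifs <;> linarith [hq k]
    · have h1 := h.le_threshold i k
      simp only [SpreadState.next, choice, ho, if_true, true_and, addLoad]
      split_ifs <;> linarith [hq k]
    · have h1 := h.spill_le i
      simp only [SpreadState.next, ho, true_and]
      split_ifs with hi
      · subst hi
        linarith [min_le_left 1 (∑ k, w k)]
      · linarith
    · have h1 := h.potential_le
      simp only [SpreadState.next, ho, true_and, Finset.sum_add_distrib, Finset.sum_ite_eq',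
        Finset.mem_univ, if_true]
      linarith
  · have hle : ∀ k, s.tent (s.tentChoice α w) k ≤ τ - 1 := by
      simpa [Overflows] using ho
    refine ⟨fun i k => ?_, fun i k => ?_, fun i => ?_, ?_⟩
    · have h1 := h.le_tent i k
      simp only [SpreadState.next, choice, ho, if_false, false_and, addLoad]
      split_ifs <;> linarith
    · have h1 := h.le_threshold i k
      have h2 := h.le_tent i k
      simp only [SpreadState.next, choice, ho, if_false, false_and, addLoad]
      split_ifs with hi
      · subst hi
        linarith [hle k, hw' k]
      · linarith
    · simpa [SpreadState.next, ho] using h.spill_le i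
    · have h1 := h.potential_le
      have h2 : 0 ≤ (∑ k, w k) * ∑ k, α ^ s.tent (s.tentChoice α w) k :=
        mul_nonneg hv (Finset.sum_nonneg fun k _ => hα0 _ k)
      simp only [SpreadState.next, ho, false_and, if_false, add_zero]
      linarith

end SpreadState

/-- Online balancing: jobs with loads in `[0, 1]` and total load at most `m` in every dimension can
be assigned online so that no machine gets more than `τ + 2` in any dimension, whatever the number
of machines. -/
theorem exists_online_spread {ι : Type*} [Fintype ι] {m : ℕ} (hm : 1 ≤ m) {α τ : ℝ} (hα : 1 ≤ α)
    (hτ0 : 0 ≤ τ) (hτ : (Fintype.card ι : ℝ) ^ 2 * Real.exp (α - 1) ≤ α ^ (τ - 1)) :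
    ∃ B : List (ι → ℝ) → (ι → ℝ) → Fin m, ∀ (w : ℕ → ι → ℝ) (n : ℕ),
      (∀ j k, 0 ≤ w j k) → (∀ j k, w j k ≤ 1) → (∀ k, ∑ j ∈ Finset.range n, w j k ≤ m) →
      ∀ i k, ∑ j ∈ Finset.range n with B (List.ofFn fun l : Fin j => w l) (w j) = i, w j k ≤
        τ + 2 := by
  have : NeZero m := ⟨by lia⟩
  let start : SpreadState ι m := ⟨0, 0⟩
  let B : List (ι → ℝ) → (ι → ℝ) → Fin m := fun l w =>
    (l.foldl (SpreadState.next α τ) start).choice α τ w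
  refine ⟨B, fun w n hw hw' hsum => ?_⟩
  let S : ℕ → SpreadState ι m := fun t =>
    (List.ofFn fun l : Fin t => w l).foldl (SpreadState.next α τ) start
  have hS : ∀ t, S (t + 1) = (S t).next α τ (w t) := by
    intro t
    simp only [S]
    rw [List.ofFn_succ']
    simp
  have key : ∀ t ≤ n, (∀ k, ∑ i, (S t).tent i k = ∑ j ∈ Finset.range t, w j k) ∧
      (S t).Invariant α τ (fun i k => ∑ j ∈ Finset.range t with
        B (List.ofFn fun l : Fin j => w l) (w j) = i, w j k) := by
    intro t
    induction t with
    | zero =>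
      intro _
      refine ⟨fun k => by simp [S, start], ⟨?_, ?_, ?_, ?_⟩⟩
      · simp [S, start]
      · simp [S, start, hτ0]
      · simp [S, start]
      · simpa [S, start] using (spreadPotential_zero ι hm α).le
    | succ t ih =>
      intro ht
      obtain ⟨ih1, ih2⟩ := ih (by lia)
      constructor
      · intro k
        rw [hS, Finset.sum_range_succ, ← ih1]
        exact sum_addLoad _ _ _ _
      · have := ih2.next hα hτ (hw t) (hw' t) fun k => by
          rw [ih1, ← Finset.sum_range_succ]
          refine le_trans ?_ (hsum k)
          exact Finset.sum_le_sum_of_subset_of_nonneg (Finset.range_subset_range.2 ht)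
            fun j _ _ => hw j k
        rw [hS]
        convert this using 1
        funext i k
        simp only [Finset.sum_filter, Finset.sum_range_succ, addLoad, eq_comm (a := i)]
        rfl
  intro i k
  have := (key n le_rfl).2
  linarith [this.le_threshold i k, this.spill_le i]

/-! ### From balanced small and big jobs to all norms -/

theorem sum_rpow_le_rpow_sum {ι : Type*} (s : Finset ι) (f : ι → ℝ≥0) {r : ℝ} (hr : 1 ≤ r) :
    ∑ j ∈ s, f j ^ r ≤ (∑ j ∈ s, f j) ^ r := by
  classical
  induction s using Finset.induction_on with
  | empty => simp
  | insert a s ha ih =>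
    rw [Finset.sum_insert ha, Finset.sum_insert ha]
    exact (add_le_add_right ih _).trans (NNReal.add_rpow_le_rpow_add _ _ hr)

theorem sum_load {d m n : ℕ} (p : Fin n → Job d) (f : Fin n → Fin m) (k : Fin d) :
    ∑ i, load p f k i = totalLoad p k := by
  simp only [load, totalLoad]
  exact Finset.sum_fiberwise _ _ _

theorem sum_job_rpow_le {d m n : ℕ} (p : Fin n → Job d) (f : Fin n → Fin m) (k : Fin d) {r : ℝ}
    (hr : 1 ≤ r) : ∑ j, p j k ^ r ≤ ∑ i, load p f k i ^ r := by
  rw [← Finset.sum_fiberwise Finset.univ f]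
  exact Finset.sum_le_sum fun i _ => sum_rpow_le_rpow_sum _ _ hr

/-- Power mean: the `r`-th powers of the machine loads sum up to at least what perfectly balanced
loads would give. -/
theorem average_rpow_le {d m n : ℕ} (hm : 1 ≤ m) (p : Fin n → Job d) (f : Fin n → Fin m)
    (k : Fin d) {r : ℝ} (hr : 1 ≤ r) :
    m * (totalLoad p k / m) ^ r ≤ ∑ i, load p f k i ^ r := by
  have hm0 : (m : ℝ≥0) ≠ 0 := by positivity
  have h := NNReal.rpow_sum_le_const_mul_sum_rpow Finset.univ (load p f k) hr
  rw [sum_load, Finset.card_univ, Fintype.card_fin, NNReal.rpow_sub hm0, NNReal.rpow_one] at h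
  rw [NNReal.div_rpow]
  have hmr : 0 < (m : ℝ≥0) ^ r := NNReal.rpow_pos (by positivity)
  have hm1 : 0 < (m : ℝ≥0) := by positivity
  calc m * (totalLoad p k ^ r / m ^ r)
      ≤ m * ((m : ℝ≥0) ^ r / m * (∑ i, load p f k i ^ r) / m ^ r) := by gcongr
    _ = ∑ i, load p f k i ^ r := by field_simp

/-- If on every machine the small jobs (those not larger than the average machine load) have total
load at most `M` times the average and there are at most `M` big jobs, then the `r`-th powers of the
loads are controlled by the two lower bounds `average_rpow_le` and `sum_job_rpow_le` for the
optimum. Only `M ^ (r - 1)` is lost, since the small jobs have total load at most `m` times the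
average, and the power mean inequality is applied to at most `M` big jobs at a time. -/
theorem sum_load_rpow_le {d m n : ℕ} (hm : 1 ≤ m) (p : Fin n → Job d) (f : Fin n → Fin m)
    (k : Fin d) {M : ℝ≥0} {r : ℝ} (hr : 1 ≤ r)
    (hsmall : ∀ i, ∑ j with f j = i ∧ p j k ≤ totalLoad p k / m, p j k ≤
      M * (totalLoad p k / m))
    (hbig : ∀ i,
      ((Finset.univ.filter fun j => f j = i ∧ totalLoad p k / m < p j k).card : ℝ≥0) ≤ M) :
    ∑ i, load p f k i ^ r ≤
      (2 * M) ^ (r - 1) * (m * (totalLoad p k / m) ^ r + ∑ j, p j k ^ r) := by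
  set a := totalLoad p k / m with ha
  have hm0 : (m : ℝ≥0) ≠ 0 := by positivity
  have hma : m * a = totalLoad p k := by rw [ha]; field_simp
  have hr0 : 0 ≤ r - 1 := by linarith
  have rpow_split : ∀ x : ℝ≥0, x ^ r = x ^ (r - 1) * x := by
    intro x
    nth_rewrite 3 [← NNReal.rpow_one x]
    rw [← NNReal.rpow_add_of_nonneg x hr0 zero_le_one, sub_add_cancel]
  set S : Fin m → ℝ≥0 := fun i => ∑ j with f j = i ∧ p j k ≤ a, p j k with hS
  set B : Fin m → ℝ≥0 := fun i => ∑ j with f j = i ∧ a < p j k, p j k with hB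
  have hsplit : ∀ i, load p f k i = S i + B i := by
    intro i
    simp only [load, hS, hB]
    rw [← Finset.sum_filter_add_sum_filter_not _ (fun j => p j k ≤ a)]
    simp only [Finset.filter_filter, not_le]
  have hSsum : ∑ i, S i ≤ m * a := by
    rw [hma, ← sum_load p f k]
    exact Finset.sum_le_sum fun i _ => by rw [hsplit]; exact le_self_add
  have hSr : ∑ i, S i ^ r ≤ M ^ (r - 1) * (m * a ^ r) := by
    calc ∑ i, S i ^ r ≤ ∑ i, (M * a) ^ (r - 1) * S i := by
          refine Finset.sum_le_sum fun i _ => ?_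
          rw [rpow_split]
          gcongr
          exact hsmall i
      _ ≤ (M * a) ^ (r - 1) * (m * a) := by rw [← Finset.mul_sum]; gcongr
      _ = M ^ (r - 1) * (m * a ^ r) := by rw [NNReal.mul_rpow, rpow_split a]; ring
  have hBr : ∑ i, B i ^ r ≤ M ^ (r - 1) * ∑ j, p j k ^ r := by
    calc ∑ i, B i ^ r ≤ ∑ i, M ^ (r - 1) * ∑ j with f j = i, p j k ^ r := by
          refine Finset.sum_le_sum fun i _ => ?_
          refine (NNReal.rpow_sum_le_const_mul_sum_rpow _ _ hr).trans ?_
          gcongr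
          · exact hbig i
          · tauto
      _ = M ^ (r - 1) * ∑ j, p j k ^ r := by
          rw [← Finset.mul_sum, Finset.sum_fiberwise]
  calc ∑ i, load p f k i ^ r ≤ ∑ i, 2 ^ (r - 1) * (S i ^ r + B i ^ r) := by
        refine Finset.sum_le_sum fun i _ => ?_
        rw [hsplit]
        exact NNReal.rpow_add_le_mul_rpow_add_rpow _ _ hr
    _ = 2 ^ (r - 1) * (∑ i, S i ^ r + ∑ i, B i ^ r) := by
        rw [← Finset.mul_sum, Finset.sum_add_distrib]
    _ ≤ 2 ^ (r - 1) * (M ^ (r - 1) * (m * a ^ r) + M ^ (r - 1) * ∑ j, p j k ^ r) := by gcongr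
    _ = _ := by rw [NNReal.mul_rpow]; ring

/-- The comparison with the optimum that results from `sum_load_rpow_le`: a bound `M` for the small
and the big jobs on each machine serves all norms at once. -/
theorem lrNorm_load_le {d m n : ℕ} (hm : 1 ≤ m) (p : Fin n → Job d) (f : Fin n → Fin m)
    (k : Fin d) {M : ℝ≥0} {r : ℝ} (hr : 1 ≤ r)
    (hsmall : ∀ i, ∑ j with f j = i ∧ p j k ≤ totalLoad p k / m, p j k ≤
      M * (totalLoad p k / m))
    (hbig : ∀ i,
      ((Finset.univ.filter fun j => f j = i ∧ totalLoad p k / m < p j k).card : ℝ≥0) ≤ M) :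
    lrNorm r (load p f k) ≤ 2 * (2 * M) ^ ((r - 1) / r) * optNorm m p k r := by
  have : Nonempty (Fin n → Fin m) := ⟨fun _ => ⟨0, hm⟩⟩
  have hr0 : 0 < r := by linarith
  obtain ⟨g, hg⟩ : ∃ g : Fin n → Fin m, lrNorm r (load p g k) = optNorm m p k r :=
    exists_eq_ciInf_of_finite
  rw [← hg]
  have h1 := sum_load_rpow_le hm p f k hr hsmall hbig
  have h2 := average_rpow_le hm p g k hr
  have h3 := sum_job_rpow_le p g k hr
  have h4 : ∑ i, load p f k i ^ r ≤ 2 * (2 * M) ^ (r - 1) * ∑ i, load p g k i ^ r := by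
    calc _ ≤ _ := h1
      _ ≤ (2 * M) ^ (r - 1) * (∑ i, load p g k i ^ r + ∑ i, load p g k i ^ r) := by gcongr
      _ = _ := by ring
  calc lrNorm r (load p f k) ≤ (2 * (2 * M) ^ (r - 1) * ∑ i, load p g k i ^ r) ^ (1 / r) :=
        NNReal.rpow_le_rpow h4 (by positivity)
    _ = 2 ^ (1 / r) * (2 * M) ^ ((r - 1) / r) * lrNorm r (load p g k) := by
        rw [NNReal.mul_rpow, NNReal.mul_rpow, ← NNReal.rpow_mul, lrNorm]
        congr 3
        ring
    _ ≤ _ := by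
        gcongr
        calc (2 : ℝ≥0) ^ (1 / r) ≤ 2 ^ (1 : ℝ) := by
              apply NNReal.rpow_le_rpow_of_exponent_le (by norm_num)
              rw [div_le_one hr0]; exact hr
          _ = 2 := NNReal.rpow_one 2

/-- The load of a job in `2 d` derived dimensions, relative to the average machine loads `a`:
`inl k` holds the scaled load in dimension `k` if the job is small there, and `inr k` counts the job
if it is big there. If `a k = 0` then no job has a load in dimension `k`, and the quotient
`b k / a k = 0 / 0 = 0` is the right value. -/
noncomputable def classify {d : ℕ} (a : Fin d → ℝ≥0) (b : Job d) : Fin d ⊕ Fin d → ℝ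
  | .inl k => if b k ≤ a k then (b k / a k : ℝ≥0) else 0
  | .inr k => if a k < b k then 1 else 0

theorem classify_nonneg {d : ℕ} (a : Fin d → ℝ≥0) (b : Job d) (κ) : 0 ≤ classify a b κ := by
  rcases κ with k | k <;> simp only [classify] <;> split_ifs <;> positivity

theorem classify_le_one {d : ℕ} (a : Fin d → ℝ≥0) (b : Job d) (κ) : classify a b κ ≤ 1 := by
  rcases κ with k | k <;> simp only [classify] <;> split_ifs with h <;> simp
  rw [← NNReal.coe_div]
  exact_mod_cast div_le_one_of_le₀ h zero_le

theorem classify_le_div {d : ℕ} (a : Fin d → ℝ≥0) (b : Job d) (k : Fin d) (ha : 0 < a k) :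
    classify a b (.inl k) ≤ b k / a k ∧ classify a b (.inr k) ≤ b k / a k := by
  have ha' : (0 : ℝ) < a k := ha
  constructor <;> simp only [classify] <;> split_ifs with h
  · simp
  · positivity
  · rw [le_div_iff₀ ha', one_mul]; exact_mod_cast h.le
  · positivity

theorem sum_classify_le {d m n : ℕ} (hm : 1 ≤ m) (p : Fin n → Job d) (κ : Fin d ⊕ Fin d) :
    ∑ j, classify (fun k => totalLoad p k / m) (p j) κ ≤ m := by
  have hm0 : (m : ℝ) ≠ 0 := by positivity
  obtain ⟨k, hk⟩ : ∃ k, κ = .inl k ∨ κ = .inr k := by rcases κ with k | k <;> simp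
  rcases eq_or_ne (totalLoad p k) 0 with h0 | h0
  · have hp : ∀ j, p j k = 0 := by simpa [totalLoad] using h0
    have : ∀ j, classify (fun k => totalLoad p k / m) (p j) κ = 0 := by
      intro j
      rcases hk with rfl | rfl <;> simp [classify, hp j]
    simp [this]
  · have ha : 0 < totalLoad p k / m := by positivity
    calc ∑ j, classify (fun k => totalLoad p k / m) (p j) κ
        ≤ ∑ j, (p j k : ℝ) / (totalLoad p k / m : ℝ≥0) := by
          refine Finset.sum_le_sum fun j _ => ?_
          have := classify_le_div (fun k => totalLoad p k / m) (p j) k ha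
          rcases hk with rfl | rfl
          exacts [this.1, this.2]
      _ = m := by
          rw [← Finset.sum_div]
          have h1 : ∑ j, (p j k : ℝ) = (totalLoad p k : ℝ) := by simp [totalLoad]
          have h2 : (totalLoad p k : ℝ) ≠ 0 := by exact_mod_cast h0
          rw [h1, NNReal.coe_div, NNReal.coe_natCast]
          field_simp

theorem one_lt_log_natCast {d : ℕ} (hd : 3 ≤ d) : 1 < Real.log d := by
  rw [Real.lt_log_iff_exp_lt (by positivity)]
  exact Real.exp_one_lt_three.trans_le (by exact_mod_cast hd)

theorem one_le_logRatio {d : ℕ} (hd : 3 ≤ d) : 1 ≤ logRatio d := by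
  have h := one_lt_log_natCast hd
  rw [logRatio, le_div_iff₀ (Real.log_pos h), one_mul]
  linarith [Real.log_le_sub_one_of_pos (x := Real.log d) (by linarith)]

/-- Balancing the classified jobs gives an algorithm that is competitive in all norms and all
dimensions. The parameters are `α = log d`, for which `exp α = d`, and `τ = 1 + 5 * logRatio d`,
for which `α ^ (τ - 1) = d ^ 5`. -/
theorem exists_online_le_optNorm {d m : ℕ} (hd : 3 ≤ d) (hm : 1 ≤ m) :
    ∃ A : OnlineAlgorithm (Fin d → ℝ≥0) d m,
      ∀ (n : ℕ) (p : Fin n → Job d) (k : Fin d) (r : ℝ), 1 ≤ r →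
        (lrNorm r (load p (A.run (totalLoad p) p) k) : ℝ) ≤
          32 * logRatio d ^ ((r - 1) / r) * (optNorm m p k r : ℝ) := by
  have hρ := one_le_logRatio hd
  have hlog := one_lt_log_natCast hd
  have hd0 : (0 : ℝ) < d := by positivity
  have hd3 : (3 : ℝ) ≤ d := by exact_mod_cast hd
  have hτ : (Fintype.card (Fin d ⊕ Fin d) : ℝ) ^ 2 * Real.exp (Real.log d - 1) ≤
      Real.log d ^ (1 + 5 * logRatio d - 1) := by
    have e1 : Real.log d ^ (1 + 5 * logRatio d - 1) = (d : ℝ) ^ 5 := by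
      rw [Real.rpow_def_of_pos (by linarith), logRatio]
      have : Real.log (Real.log d) ≠ 0 := (Real.log_pos hlog).ne'
      rw [show Real.log (Real.log d) * (1 + 5 * (Real.log d / Real.log (Real.log d)) - 1) =
        (5 : ℕ) * Real.log d by push_cast; field_simp; ring, Real.exp_nat_mul, Real.exp_log hd0]
    have e2 : Real.exp (Real.log d - 1) ≤ d := by
      calc Real.exp (Real.log d - 1) ≤ Real.exp (Real.log d) := Real.exp_le_exp.2 (by linarith)
        _ = d := Real.exp_log hd0
    rw [e1]
    calc _ ≤ (Fintype.card (Fin d ⊕ Fin d) : ℝ) ^ 2 * d := by gcongr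
      _ = 4 * (d : ℝ) ^ 3 := by simp; ring
      _ ≤ (d : ℝ) ^ 2 * (d : ℝ) ^ 3 := by gcongr; nlinarith
      _ = _ := by ring
  obtain ⟨B, hB⟩ := exists_online_spread (ι := Fin d ⊕ Fin d) hm hlog.le (by linarith) hτ
  let A : OnlineAlgorithm (Fin d → ℝ≥0) d m := fun T hist b =>
    B (hist.map (classify fun k => T k / m)) (classify (fun k => T k / m) b)
  refine ⟨A, fun n p k r hr => ?_⟩
  set a : Fin d → ℝ≥0 := fun k => totalLoad p k / m with ha
  -- the classified jobs, continued by zero jobs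
  let w : ℕ → Fin d ⊕ Fin d → ℝ := fun j => if h : j < n then classify a (p ⟨j, h⟩) else 0
  have hw : ∀ j : Fin n, w j = classify a (p j) := fun j => by simp [w]
  have hrun : ∀ j : Fin n, A.run (totalLoad p) p j = B (List.ofFn fun l : Fin j => w l) (w j) := by
    intro j
    simp only [OnlineAlgorithm.run, A]
    rw [hw, List.map_ofFn]
    congr 2
    funext l
    exact (hw (Fin.castLE j.isLt.le l)).symm
  have hbound : ∀ i κ, ∑ j with A.run (totalLoad p) p j = i, classify a (p j) κ ≤
      3 + 5 * logRatio d := by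
    intro i κ
    have := hB w n (fun j κ => by
        simp only [w]; split_ifs; exacts [classify_nonneg _ _ _, le_rfl])
      (fun j κ => by
        simp only [w]; split_ifs; exacts [classify_le_one _ _ _, zero_le_one])
      (fun κ => by
        rw [Finset.sum_range]
        simpa only [hw] using sum_classify_le hm p κ) i κ
    rw [Finset.sum_filter, Finset.sum_range] at this
    simp only [hw] at this
    rw [Finset.sum_filter]
    simp only [hrun, hw]
    linarith
  set M : ℝ≥0 := ⟨8 * logRatio d, by linarith⟩ with hM
  have hMr : (M : ℝ) = 8 * logRatio d := rfl
  have key := lrNorm_load_le (M := M) hm p (A.run (totalLoad p) p) k hr ?_ ?_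
  · calc (lrNorm r (load p (A.run (totalLoad p) p) k) : ℝ)
        ≤ 2 * (2 * (8 * logRatio d)) ^ ((r - 1) / r) * (optNorm m p k r : ℝ) := by
          exact_mod_cast key
      _ ≤ 32 * logRatio d ^ ((r - 1) / r) * (optNorm m p k r : ℝ) := by
          have h1 : (2 * (8 * logRatio d)) ^ ((r - 1) / r) ≤
              16 * logRatio d ^ ((r - 1) / r) := by
            rw [← mul_assoc, Real.mul_rpow (by norm_num) (by linarith)]
            gcongr
            calc ((2 : ℝ) * 8) ^ ((r - 1) / r) ≤ (2 * 8) ^ (1 : ℝ) := by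
                  apply Real.rpow_le_rpow_of_exponent_le (by norm_num)
                  rw [div_le_one (by linarith)]; linarith
              _ = 16 := by norm_num
          calc _ ≤ 2 * (16 * logRatio d ^ ((r - 1) / r)) * (optNorm m p k r : ℝ) := by
                gcongr
            _ = _ := by ring
  · intro i
    have h := hbound i (.inl k)
    rcases eq_or_ne (a k) 0 with h0 | h0
    · change ∑ j with _ ∧ p j k ≤ a k, p j k ≤ M * a k
      refine (Finset.sum_eq_zero fun j hj => ?_).trans_le zero_le
      simpa [h0] using (Finset.mem_filter.1 hj).2.2
    · change ∑ j with _ ∧ p j k ≤ a k, p j k ≤ M * a k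
      have h0' : (0 : ℝ) < a k := by positivity
      rw [← NNReal.coe_le_coe, NNReal.coe_sum, NNReal.coe_mul, hMr, ← div_le_iff₀ h0',
        Finset.sum_div]
      simp only [classify, ← Finset.sum_filter, Finset.filter_filter, NNReal.coe_div] at h
      linarith
  · intro i
    have h := hbound i (.inr k)
    rw [← NNReal.coe_le_coe, hMr, NNReal.coe_natCast]
    simp only [classify, ← Finset.sum_filter, Finset.filter_filter, Finset.sum_const,
      nsmul_eq_mul, mul_one] at h
    linarith

/-! ### Forcing a monochromatic clique in an online colouring -/

/-- The number of sets of the family `G` that contain `γ`. -/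
def multiplicity {M : ℕ} (G : Fin M → Finset (Fin M)) (γ : Fin M) : ℕ :=
  (Finset.univ.filter fun i => γ ∈ G i).card

theorem sum_multiplicity {M : ℕ} (G : Fin M → Finset (Fin M)) :
    ∑ γ, multiplicity G γ = ∑ i, (G i).card := by
  simp only [multiplicity, Finset.card_filter]
  rw [Finset.sum_comm]
  simp

theorem sum_sq_multiplicity_le {M : ℕ} (G : Fin M → Finset (Fin M)) :
    ∑ γ, multiplicity G γ ^ 2 ≤ M ^ 3 := by
  calc ∑ γ, multiplicity G γ ^ 2 ≤ ∑ _γ : Fin M, M ^ 2 := by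
        refine Finset.sum_le_sum fun γ _ => Nat.pow_le_pow_left ?_ 2
        exact (Finset.card_le_univ _).trans (by simp)
    _ = M ^ 3 := by simp; ring

/-- If the sets are small, there are two colours of equal multiplicity that no set contains both.
Most colours have multiplicity below `2 * q`, so many of them share one multiplicity, while a colour
of multiplicity below `2 * q` shares a set with fewer than `2 * q ^ 2` others. The last `q` colours
are kept in reserve and avoided. -/
theorem exists_pair_multiplicity_eq {q M : ℕ} (hq : 1 ≤ q) (hM : 16 * q ^ 3 ≤ M)
    (G : Fin M → Finset (Fin M)) (hG : ∀ i, (G i).card < q) :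
    ∃ γ γ' : Fin M, γ ≠ γ' ∧ (γ : ℕ) + q < M ∧ (γ' : ℕ) + q < M ∧
      multiplicity G γ = multiplicity G γ' ∧ ∀ i, γ ∈ G i → γ' ∉ G i := by
  classical
  have hq3 : q ≤ q ^ 3 := Nat.le_self_pow (by norm_num) q
  -- the colours of multiplicity at least `2 q` and the reserved colours
  set heavy := Finset.univ.filter fun γ => 2 * q ≤ multiplicity G γ with hheavy
  set top := Finset.univ.filter fun γ : Fin M => M ≤ (γ : ℕ) + q with htop
  have h1 : 2 * heavy.card ≤ M := by
    have h2 : heavy.card * (2 * q) ≤ ∑ γ, multiplicity G γ := by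
      calc heavy.card * (2 * q) = ∑ _γ ∈ heavy, 2 * q := by simp
        _ ≤ ∑ γ ∈ heavy, multiplicity G γ :=
            Finset.sum_le_sum fun γ hγ => (Finset.mem_filter.1 hγ).2
        _ ≤ _ := Finset.sum_le_sum_of_subset (Finset.subset_univ _)
    have h3 : ∑ i, (G i).card ≤ M * q := by
      calc ∑ i, (G i).card ≤ ∑ _i : Fin M, q := Finset.sum_le_sum fun i _ => (hG i).le
        _ = M * q := by simp
    rw [sum_multiplicity] at h2
    exact Nat.le_of_mul_le_mul_right (c := q) (by nlinarith) hq
  have h2 : top.card ≤ q := by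
    have : top.card = (top.image fun γ : Fin M => (γ : ℕ)).card :=
      (Finset.card_image_of_injective _ Fin.val_injective).symm
    rw [this]
    calc _ ≤ (Finset.Ico (M - q) M).card := by
          apply Finset.card_le_card
          intro a ha
          obtain ⟨γ, hγ, rfl⟩ := Finset.mem_image.1 ha
          have := (Finset.mem_filter.1 hγ).2
          rw [Finset.mem_Ico]
          lia
      _ ≤ q := by rw [Nat.card_Ico]; lia
  set light := (Finset.univ \ heavy) \ top with hlight
  have hlight_mem : ∀ γ ∈ light, (γ : ℕ) + q < M ∧ multiplicity G γ < 2 * q := by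
    intro γ hγ
    simp only [hlight, hheavy, htop, Finset.mem_sdiff, Finset.mem_univ, Finset.mem_filter,
      true_and, not_le] at hγ
    exact ⟨hγ.2, hγ.1⟩
  have h3 : (Finset.range (2 * q)).card * (2 * q ^ 2) < light.card := by
    have e1 := Finset.le_card_sdiff heavy (Finset.univ : Finset (Fin M))
    have e2 := Finset.le_card_sdiff top (Finset.univ \ heavy)
    rw [Finset.card_univ, Fintype.card_fin] at e1
    rw [Finset.card_range]
    have e3 : 2 * q * (2 * q ^ 2) = 4 * q ^ 3 := by ring
    rw [e3]
    lia
  obtain ⟨x, hx, hfib⟩ := Finset.exists_lt_card_fiber_of_mul_lt_card_of_maps_to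
    (f := multiplicity G) (fun γ hγ => Finset.mem_range.2 (hlight_mem γ hγ).2) h3
  set X := light.filter fun γ => multiplicity G γ = x with hX
  obtain ⟨γ, hγ⟩ : X.Nonempty := Finset.card_pos.1 (by lia)
  have hγx : multiplicity G γ = x := (Finset.mem_filter.1 hγ).2
  have hγl := hlight_mem γ (Finset.mem_filter.1 hγ).1
  -- the colours that share a set with `γ`
  set bad := (Finset.univ.filter fun i => γ ∈ G i).biUnion fun i => (G i).erase γ with hbad
  have hbadcard : bad.card + 1 < X.card := by
    have e1 : bad.card ≤ multiplicity G γ * (q - 1) := by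
      refine Finset.card_biUnion_le_card_mul _ _ _ fun i _ => ?_
      have := (Finset.card_erase_le (s := G i) (a := γ))
      have := hG i
      lia
    have e2 : multiplicity G γ * (q - 1) ≤ 2 * q * (q - 1) := by
      gcongr
      exact hγl.2.le
    have e3 : 2 * q * (q - 1) + 2 ≤ 2 * q ^ 2 := by
      obtain ⟨s, rfl⟩ : ∃ s, q = s + 1 := ⟨q - 1, by lia⟩
      simp only [Nat.add_sub_cancel]
      nlinarith
    lia
  obtain ⟨γ', hγ', hnot⟩ : ∃ γ' ∈ X, γ' ∉ insert γ bad :=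
    Finset.exists_mem_notMem_of_card_lt_card
      ((Finset.card_insert_le _ _).trans_lt hbadcard)
  simp only [Finset.mem_insert, not_or] at hnot
  refine ⟨γ, γ', fun h => hnot.1 h.symm, hγl.1, (hlight_mem γ' (Finset.mem_filter.1 hγ').1).1,
    hγx.trans (Finset.mem_filter.1 hγ').2.symm, fun i hi hi' => hnot.2 ?_⟩
  exact Finset.mem_biUnion.2 ⟨i, Finset.mem_filter.2 ⟨Finset.mem_univ _, hi⟩,
    Finset.mem_erase.2 ⟨hnot.1, hi'⟩⟩

/-- Adding `γ` to one of the sets, in exchange for `γ'` if that was there, increases the sum of the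
squared multiplicities, provided the two multiplicities were equal. -/
theorem sum_sq_multiplicity_lt {M : ℕ} {G G' : Fin M → Finset (Fin M)} {i γ γ' : Fin M}
    (hne : γ ≠ γ') (heq : multiplicity G γ = multiplicity G γ') (hγ : γ ∉ G i)
    (hother : ∀ j ≠ i, G' j = G j) (hi : G' i = insert γ ((G i).erase γ')) :
    ∑ c, multiplicity G c ^ 2 < ∑ c, multiplicity G' c ^ 2 := by
  classical
  set y : Fin M → ℕ := fun c => (Finset.univ.filter fun j => j ≠ i ∧ c ∈ G j).card with hy
  have hsplit : ∀ (H : Fin M → Finset (Fin M)), (∀ j ≠ i, H j = G j) → ∀ c,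
      multiplicity H c = y c + if c ∈ H i then 1 else 0 := by
    intro H hH c
    have e1 : (Finset.univ.filter fun j => c ∈ H j) =
        (Finset.univ.filter fun j => j ≠ i ∧ c ∈ G j) ∪ (if c ∈ H i then {i} else ∅) := by
      ext j
      by_cases hj : j = i
      · subst hj
        by_cases hc : c ∈ H j <;> simp [hc]
      · split_ifs <;> simp [hj, hH j hj]
    rw [multiplicity, e1, Finset.card_union_of_disjoint]
    · congr 1
      split_ifs <;> simp
    · split_ifs <;> simp
  have hG := hsplit G fun _ _ => rfl
  have hG' := hsplit G' hother
  have hrest : ∑ c ∈ (Finset.univ.erase γ).erase γ', multiplicity G' c ^ 2 =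
      ∑ c ∈ (Finset.univ.erase γ).erase γ', multiplicity G c ^ 2 := by
    refine Finset.sum_congr rfl fun c hc => ?_
    simp only [Finset.mem_erase, Finset.mem_univ, and_true] at hc
    rw [hG, hG', hi]
    simp [hc.1, hc.2]
  have hmem : γ' ∈ Finset.univ.erase γ := by simp [hne.symm]
  rw [← Finset.add_sum_erase _ _ (Finset.mem_univ γ), ← Finset.add_sum_erase _ _ hmem,
    ← Finset.add_sum_erase _ (fun c => multiplicity G' c ^ 2) (Finset.mem_univ γ),
    ← Finset.add_sum_erase _ (fun c => multiplicity G' c ^ 2) hmem, hrest]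
  have a1 : multiplicity G γ = y γ := by rw [hG]; simp [hγ]
  have a2 : multiplicity G' γ = y γ + 1 := by rw [hG', hi]; simp
  have a3 : multiplicity G' γ' = y γ' := by rw [hG', hi]; simp [hne.symm]
  have a4 := hG γ'
  rw [← heq, a1] at a4
  rw [← heq, a1, a2, a3]
  split_ifs at a4 <;> nlinarith

/-- A position after `t` vertices of the game against an online colouring `col` with `M` colours.
The graph joins `v` to the earlier vertices in `Nb v`; `g` is a proper colouring of it, fixed by the
adversary and avoiding the last `q` colours; and `Q i` is a clique of vertices on which the online
algorithm has used colour `i`. -/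
structure CliquePosition {M : ℕ} (col : (ℕ → Finset ℕ) → ℕ → Fin M) (q t : ℕ)
    (Nb : ℕ → Finset ℕ) (g : ℕ → Fin M) (Q : Fin M → Finset ℕ) : Prop where
  lt : ∀ i, ∀ v ∈ Q i, v < t
  color : ∀ i, ∀ v ∈ Q i, col Nb v = i
  adj : ∀ i, ∀ u ∈ Q i, ∀ v ∈ Q i, u < v → u ∈ Nb v
  proper : ∀ v < t, ∀ u ∈ Nb v, u < v ∧ g u ≠ g v
  low : ∀ v < t, (g v : ℕ) + q < M

/-- One move of the adversary. Two colours of equal multiplicity among the sets `g '' Q i` are left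
open, and the new vertex is joined to all the cliques except for their vertices of the open colours.
Whatever colour `i` the algorithm uses, one of the open colours is missing in `g '' Q i`, and the new
vertex receives it. It replaces the vertices of open colour in `Q i`, of which there is at most
one. -/
theorem CliquePosition.exists_step {M q t : ℕ} {col : (ℕ → Finset ℕ) → ℕ → Fin M}
    (hcol : ∀ Nb Nb' v, (∀ u ≤ v, Nb u = Nb' u) → col Nb v = col Nb' v)
    {Nb : ℕ → Finset ℕ} {g : ℕ → Fin M} {Q : Fin M → Finset ℕ} (hq : 1 ≤ q)
    (hM : 16 * q ^ 3 ≤ M) (h : CliquePosition col q t Nb g Q) (hsmall : ∀ i, (Q i).card < q) :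
    ∃ Nb' g' Q', CliquePosition col q (t + 1) Nb' g' Q' ∧ (∀ i, (Q' i).card ≤ q) ∧
      ∑ γ, multiplicity (fun i => (Q i).image g) γ ^ 2 <
        ∑ γ, multiplicity (fun i => (Q' i).image g') γ ^ 2 := by
  classical
  obtain ⟨γ₁, γ₂, hne, hlow₁, hlow₂, heq, hdisj⟩ := exists_pair_multiplicity_eq hq hM
    (fun i => (Q i).image g) fun i => Finset.card_image_le.trans_lt (hsmall i)
  set Nb' := Function.update Nb t
    ((Finset.univ.biUnion Q).filter fun u => g u ≠ γ₁ ∧ g u ≠ γ₂) with hNb'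
  set i := col Nb' t with hi
  -- the new vertex takes whichever of the two colours does not occur in the clique it joins
  obtain ⟨γ, γ', hγ, hne', heq', hγi, hlow⟩ : ∃ γ γ', (∀ c, (c ≠ γ₁ ∧ c ≠ γ₂) ↔ (c ≠ γ ∧ c ≠ γ')) ∧
      γ ≠ γ' ∧ multiplicity (fun i => (Q i).image g) γ = multiplicity (fun i => (Q i).image g) γ' ∧
      γ ∉ (Q i).image g ∧ (γ : ℕ) + q < M := by
    by_cases h1 : γ₁ ∈ (Q i).image g
    · exact ⟨γ₂, γ₁, fun c => and_comm, hne.symm, heq.symm, hdisj i h1, hlow₂⟩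
    · exact ⟨γ₁, γ₂, fun c => Iff.rfl, hne, heq, h1, hlow₁⟩
  set g' := Function.update g t γ with hg'
  set Q' := Function.update Q i (insert t ((Q i).filter fun u => g u ≠ γ₁ ∧ g u ≠ γ₂)) with hQ'
  have hNbt : ∀ v < t, Nb' v = Nb v := fun v hv => Function.update_of_ne hv.ne _ _
  have hgt : ∀ v < t, g' v = g v := fun v hv => Function.update_of_ne hv.ne _ _
  have hcolt : ∀ v < t, col Nb' v = col Nb v := fun v hv =>
    hcol _ _ _ fun u hu => hNbt u (hu.trans_lt hv)
  have hQi : ∀ v, v ∈ Q' i ↔ v = t ∨ v ∈ Q i ∧ g v ≠ γ₁ ∧ g v ≠ γ₂ := by simp [hQ']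
  have hQj : ∀ j ≠ i, Q' j = Q j := fun j hj => Function.update_of_ne hj _ _
  have himage : ∀ j, (Q j).image g' = (Q j).image g := fun j =>
    Finset.image_congr fun v hv => hgt v (h.lt j v hv)
  refine ⟨Nb', g', Q', ⟨fun j v hv => ?_, fun j v hv => ?_, fun j u hu v hv huv => ?_,
    fun v hv u hu => ?_, fun v hv => ?_⟩, fun j => ?_, ?_⟩
  · by_cases hj : j = i
    · subst hj
      rcases (hQi v).1 hv with rfl | hv
      · lia
      · have := h.lt _ v hv.1
        lia
    · rw [hQj j hj] at hv
      have := h.lt j v hv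
      lia
  · by_cases hj : j = i
    · subst hj
      rcases (hQi v).1 hv with rfl | hv
      · rfl
      · rw [hcolt v (h.lt _ v hv.1), h.color _ v hv.1]
    · rw [hQj j hj] at hv
      rw [hcolt v (h.lt _ v hv), h.color _ v hv]
  · by_cases hj : j = i
    · subst hj
      rcases (hQi v).1 hv with rfl | hv
      · rcases (hQi u).1 hu with rfl | hu
        · lia
        · simp only [hNb', Function.update_self, Finset.mem_filter, Finset.mem_biUnion,
            Finset.mem_univ, true_and]
          exact ⟨⟨i, hu.1⟩, hu.2⟩
      · have hvt := h.lt _ v hv.1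
        rcases (hQi u).1 hu with rfl | hu
        · lia
        · rw [hNbt v hvt]
          exact h.adj _ u hu.1 v hv.1 huv
    · rw [hQj j hj] at hu hv
      rw [hNbt v (h.lt _ v hv)]
      exact h.adj _ u hu v hv huv
  · rcases Nat.lt_succ_iff_lt_or_eq.1 hv with hv | rfl
    · rw [hNbt v hv] at hu
      obtain ⟨h1, h2⟩ := h.proper v hv u hu
      exact ⟨h1, by rwa [hgt u (h1.trans hv), hgt v hv]⟩
    · simp only [hNb', Function.update_self, Finset.mem_filter, Finset.mem_biUnion,
        Finset.mem_univ, true_and] at hu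
      obtain ⟨⟨j, hj⟩, hu⟩ := hu
      have hut := h.lt j u hj
      refine ⟨hut, ?_⟩
      rw [hgt u hut]
      simpa [hg'] using ((hγ _).1 hu).1
  · rcases Nat.lt_succ_iff_lt_or_eq.1 hv with hv | rfl
    · rw [hgt v hv]; exact h.low v hv
    · simpa [hg'] using hlow
  · by_cases hj : j = i
    · subst hj
      simp only [hQ', Function.update_self]
      have h1 := hsmall i
      have h2 := Finset.card_filter_le (Q i) fun u => g u ≠ γ₁ ∧ g u ≠ γ₂
      exact (Finset.card_insert_le _ _).trans (by lia)
    · rw [hQj j hj]; exact (hsmall j).le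
  · refine sum_sq_multiplicity_lt (i := i) hne' heq' hγi (fun j hj => ?_) ?_
    · rw [hQj j hj, himage]
    · ext c
      simp only [Finset.mem_image, Finset.mem_insert, Finset.mem_erase, hQi]
      constructor
      · rintro ⟨v, rfl | hv, rfl⟩
        · left; simp [hg']
        · rw [hgt v (h.lt _ v hv.1)]
          exact .inr ⟨((hγ _).1 hv.2).2, v, hv.1, rfl⟩
      · rintro (rfl | ⟨hc, v, hv, rfl⟩)
        · exact ⟨t, .inl rfl, by simp [hg']⟩
        · refine ⟨v, .inr ⟨hv, (hγ _).2 ⟨fun e => hγi ?_, hc⟩⟩, hgt v (h.lt _ v hv)⟩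
          exact Finset.mem_image.2 ⟨v, hv, e⟩

/-- Every online colouring with `M ≥ 16 * q ^ 3` colours can be forced to have a monochromatic clique
of size `q` within `M ^ 3 + 1` vertices, in a graph that the adversary colours properly with the same
colours: the sum of the squared multiplicities grows with every move, and it is at most `M ^ 3`. The
hypothesis on `col` says that the colouring is online. -/
theorem exists_monochromatic_clique {M q : ℕ} {col : (ℕ → Finset ℕ) → ℕ → Fin M}
    (hcol : ∀ Nb Nb' v, (∀ u ≤ v, Nb u = Nb' u) → col Nb v = col Nb' v)
    (hq : 1 ≤ q) (hM : 16 * q ^ 3 ≤ M) :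
    ∃ t Nb g Q i, t ≤ M ^ 3 + 1 ∧ CliquePosition col q t Nb g Q ∧ (Q i).card = q := by
  by_contra! hcon
  have hM0 : 0 < M := lt_of_lt_of_le (by positivity) hM
  have key : ∀ t ≤ M ^ 3 + 1, ∃ Nb g Q, CliquePosition col q t Nb g Q ∧
      (∀ i, (Q i).card < q) ∧ t ≤ ∑ γ, multiplicity (fun i => (Q i).image g) γ ^ 2 := by
    intro t
    induction t with
    | zero =>
      intro _
      exact ⟨fun _ => ∅, fun _ => ⟨0, hM0⟩, fun _ => ∅, ⟨by simp, by simp, by simp, by simp,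
        by simp⟩, by simp; lia, by simp⟩
    | succ t ih =>
      intro ht
      obtain ⟨Nb, g, Q, h, hs, hp⟩ := ih (by lia)
      obtain ⟨Nb', g', Q', h', hs', hp'⟩ := h.exists_step hcol hq hM hs
      exact ⟨Nb', g', Q', h', fun i => lt_of_le_of_ne (hs' i) (hcon _ _ _ _ i ht h'),
        by lia⟩
  obtain ⟨Nb, g, Q, -, -, hp⟩ := key _ le_rfl
  have := sum_sq_multiplicity_le fun i => (Q i).image g
  lia

/-! ### Scheduling instances from the colouring game -/

theorem load_indicator {d m n : ℕ} (U : Fin d → Finset (Fin n)) (f : Fin n → Fin m) (k : Fin d)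
    (i : Fin m) : load (fun j k => if j ∈ U k then 1 else 0) f k i =
      ((U k).filter fun j => f j = i).card := by
  simp only [load]
  rw [Finset.sum_ite_mem, Finset.sum_const, nsmul_eq_mul, mul_one]
  congr 2
  ext j
  simp [and_comm]

theorem sum_card_fiber {m n : ℕ} (s : Finset (Fin n)) (f : Fin n → Fin m) :
    ∑ i, ((s.filter fun j => f j = i).card : ℝ≥0) = s.card := by
  rw [← Nat.cast_sum, ← Finset.card_eq_sum_card_fiberwise fun j _ => Finset.mem_univ _]

theorem rpow_card_le_lrNorm_load {d m n : ℕ} (U : Fin d → Finset (Fin n)) (f : Fin n → Fin m)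
    (k : Fin d) {r : ℝ} (hr : 1 ≤ r) :
    ((U k).card : ℝ≥0) ^ (1 / r) ≤ lrNorm r (load (fun j k => if j ∈ U k then 1 else 0) f k) := by
  apply NNReal.rpow_le_rpow _ (by positivity)
  rw [← sum_card_fiber (U k) f]
  refine Finset.sum_le_sum fun i _ => ?_
  rw [load_indicator]
  rcases Nat.eq_zero_or_pos ((U k).filter fun j => f j = i).card with h | h
  · simp [h]
  · nth_rewrite 1 [← NNReal.rpow_one (((U k).filter fun j => f j = i).card : ℝ≥0)]
    exact NNReal.rpow_le_rpow_of_exponent_le (by exact_mod_cast h) hr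

theorem lrNorm_load_eq_of_injOn {d m n : ℕ} (U : Fin d → Finset (Fin n)) (f : Fin n → Fin m)
    (k : Fin d) (hf : Set.InjOn f (U k)) {r : ℝ} (hr : 1 ≤ r) :
    lrNorm r (load (fun j k => if j ∈ U k then 1 else 0) f k) = ((U k).card : ℝ≥0) ^ (1 / r) := by
  rw [lrNorm, ← sum_card_fiber (U k) f]
  congr 1
  refine Finset.sum_congr rfl fun i _ => ?_
  rw [load_indicator]
  have h : ((U k).filter fun j => f j = i).card ≤ 1 := by
    rw [Finset.card_le_one]
    intro a ha b hb
    simp only [Finset.mem_filter] at ha hb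
    exact hf ha.1 hb.1 (ha.2.trans hb.2.symm)
  interval_cases ((U k).filter fun j => f j = i).card
  · simp [show r ≠ 0 by linarith]
  · simp

theorem le_lrNorm {m : ℕ} (x : Fin m → ℝ≥0) (i : Fin m) {r : ℝ} (hr : 1 ≤ r) :
    x i ≤ lrNorm r x := by
  have hr0 : r ≠ 0 := by linarith
  calc x i = (x i ^ r) ^ (1 / r) := by
        rw [← NNReal.rpow_mul, mul_one_div_cancel hr0, NNReal.rpow_one]
    _ ≤ _ := NNReal.rpow_le_rpow (Finset.single_le_sum (f := fun i => x i ^ r)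
        (fun _ _ => zero_le) (Finset.mem_univ i)) (by positivity)

open Classical in
/-- The vertices before `t` in `S` that are joined to all earlier vertices of `S`. They form a
clique. -/
noncomputable def accepted (Nb : ℕ → Finset ℕ) (S : Finset ℕ) (t : ℕ) : Finset ℕ :=
  (Finset.range t).filter fun v => v ∈ S ∧ ∀ u ∈ S, u < v → u ∈ Nb v

open Classical in
/-- The job of the vertex `v`: it has load `1` in the dimensions `k` for which `v` is in `S k` and is
joined to all earlier vertices of `S k`, so that in every dimension the loaded vertices form a
clique. -/
noncomputable def vertexJob {d : ℕ} (S : Fin d → Finset ℕ) (Nb : ℕ → Finset ℕ) (v : ℕ) : Job d :=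
  fun k => if v ∈ S k ∧ ∀ u ∈ S k, u < v → u ∈ Nb v then 1 else 0

theorem vertexJob_congr {d : ℕ} (S : Fin d → Finset ℕ) {Nb Nb' : ℕ → Finset ℕ} {v : ℕ}
    (h : Nb v = Nb' v) : vertexJob S Nb v = vertexJob S Nb' v := by
  funext k
  simp only [vertexJob, h]

/-- Every algorithm can be forced to put the whole load `q` of some dimension on one machine, while
an offline assignment puts load at most `1` on each machine in every dimension. The optimal norms are
`q ^ (1 / r)` in every dimension and hence known beforehand, so that they carry no information. -/
theorem exists_instance_forcing_machine {d q M : ℕ} (hq : 1 ≤ q) (hM : 16 * q ^ 3 ≤ M)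
    (hd : (M ^ 3 + 1) ^ q ≤ d) (A : OnlineAlgorithm (Fin d → Set.Ici (1 : ℝ) → ℝ≥0) d M) :
    ∃ (n : ℕ) (p : Fin n → Job d) (g : Fin n → Fin M) (k : Fin d),
      (∀ k' (r : ℝ), 1 ≤ r → lrNorm r (load p g k') = (q : ℝ≥0) ^ (1 / r)) ∧
      ∀ r : ℝ, 1 ≤ r → (q : ℝ≥0) ≤ lrNorm r (load p (A.run (optTable M p) p) k) := by
  classical
  -- every sequence of `q` of the first `M ^ 3 + 1` vertices belongs to some dimension
  obtain ⟨e, he⟩ : ∃ e : Fin d → Fin q → Fin (M ^ 3 + 1), Function.Surjective e := by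
    obtain ⟨φ⟩ := Function.Embedding.nonempty_of_card_le
      (α := Fin q → Fin (M ^ 3 + 1)) (β := Fin d) (by simpa using hd)
    exact ⟨_, Function.invFun_surjective φ.injective⟩
  set S : Fin d → Finset ℕ := fun k => Finset.univ.image fun l => (e k l : ℕ) with hS
  have hScard : ∀ k, (S k).card ≤ q := fun k => Finset.card_image_le.trans (by simp)
  set info : Fin d → Set.Ici (1 : ℝ) → ℝ≥0 := fun _ r => (q : ℝ≥0) ^ (1 / (r : ℝ)) with hinfo
  set col : (ℕ → Finset ℕ) → ℕ → Fin M := fun Nb v =>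
    A info (List.ofFn fun l : Fin v => vertexJob S Nb l) (vertexJob S Nb v) with hcoldef
  have hcol : ∀ Nb Nb' v, (∀ u ≤ v, Nb u = Nb' u) → col Nb v = col Nb' v := by
    intro Nb Nb' v h
    simp only [hcoldef]
    rw [vertexJob_congr S (h v le_rfl)]
    congr 2
    funext l
    exact vertexJob_congr S (h l l.isLt.le)
  obtain ⟨t, Nb, g, Q, i, ht, hpos, hQ⟩ := exists_monochromatic_clique hcol hq hM
  -- padding jobs `t, t + 1, …` bring every dimension to exactly `q` unit jobs
  set V : Fin d → Finset ℕ := fun k =>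
    accepted Nb (S k) t ∪ Finset.Ico t (t + (q - (accepted Nb (S k) t).card)) with hV
  have hacc : ∀ k, (accepted Nb (S k) t).card ≤ q := fun k =>
    (Finset.card_le_card fun v hv => (Finset.mem_filter.1 hv).2.1).trans (hScard k)
  have hacc_lt : ∀ k, ∀ v ∈ accepted Nb (S k) t, v < t := fun k v hv =>
    Finset.mem_range.1 (Finset.mem_filter.1 hv).1
  have hVcard : ∀ k, (V k).card = q := by
    intro k
    rw [hV, Finset.card_union_of_disjoint, Nat.card_Ico]
    · have := hacc k
      lia
    · rw [Finset.disjoint_left]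
      intro v hv hv'
      have := hacc_lt k v hv
      rw [Finset.mem_Ico] at hv'
      lia
  have hVlt : ∀ k, ∀ v ∈ V k, v < t + q := by
    intro k v hv
    rcases Finset.mem_union.1 hv with hv | hv
    · have := hacc_lt k v hv
      lia
    · rw [Finset.mem_Ico] at hv
      lia
  set U : Fin d → Finset (Fin (t + q)) := fun k => (V k).attachFin (hVlt k) with hU
  have hUcard : ∀ k, (U k).card = q := fun k => by rw [hU, Finset.card_attachFin, hVcard]
  set p : Fin (t + q) → Job d := fun j k => if j ∈ U k then 1 else 0 with hp
  have hMq : q ≤ M := by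
    have : q ≤ q ^ 3 := Nat.le_self_pow (by norm_num) q
    lia
  set G : Fin (t + q) → Fin M := fun j =>
    if h : (j : ℕ) < t then g j else ⟨M - q + (j - t), by lia⟩ with hG
  have hGlt : ∀ j : Fin (t + q), (j : ℕ) < t → G j = g j := fun j h => by simp [hG, h]
  have hGge : ∀ j : Fin (t + q), t ≤ (j : ℕ) → (G j : ℕ) = M - q + (j - t) := fun j h => by
    simp [hG, not_lt.2 h]
  have hUacc : ∀ k, ∀ j ∈ U k, (j : ℕ) < t → (j : ℕ) ∈ accepted Nb (S k) t := by
    intro k j hj hjt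
    rw [hU, Finset.mem_attachFin] at hj
    rcases Finset.mem_union.1 hj with hj | hj
    · exact hj
    · rw [Finset.mem_Ico] at hj
      lia
  have hGne : ∀ k, ∀ a ∈ U k, ∀ b ∈ U k, a < b → G a ≠ G b := by
    intro k a ha b hb hab
    have hab' : (a : ℕ) < b := hab
    rcases lt_or_ge (b : ℕ) t with hbt | hbt
    · have hat := hab'.trans hbt
      rw [hGlt a hat, hGlt b hbt]
      have h1 := (Finset.mem_filter.1 (hUacc k a ha hat)).2
      have h2 := (Finset.mem_filter.1 (hUacc k b hb hbt)).2
      exact (hpos.proper b hbt a (h2.2 a h1.1 hab')).2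
    · intro h
      have h1 := hGge b hbt
      rcases lt_or_ge (a : ℕ) t with hat | hat
      · rw [← h, hGlt a hat] at h1
        have := hpos.low a hat
        lia
      · rw [← h, hGge a hat] at h1
        lia
  have hGinj : ∀ k, Set.InjOn G (U k) := by
    intro k a ha b hb hab
    rcases lt_trichotomy a b with h | h | h
    · exact absurd hab (hGne k a ha b hb h)
    · exact h
    · exact absurd hab.symm (hGne k b hb a ha h)
  have hgood : ∀ k' (r : ℝ), 1 ≤ r → lrNorm r (load p G k') = (q : ℝ≥0) ^ (1 / r) := by
    intro k r hr
    rw [lrNorm_load_eq_of_injOn U G k (hGinj k) hr, hUcard]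
  have htable : optTable M p = info := by
    funext k r
    have : Nonempty (Fin (t + q) → Fin M) := ⟨G⟩
    refine le_antisymm ?_ (le_ciInf fun f => ?_)
    · change optTable M p k r ≤ (q : ℝ≥0) ^ (1 / (r : ℝ))
      rw [← hgood k r r.2]
      exact ciInf_le (OrderBot.bddBelow _) G
    · have := rpow_card_le_lrNorm_load U f k r.2
      rwa [hUcard] at this
  -- on the vertices, the algorithm behaves as in the colouring game
  have hpv : ∀ j : Fin (t + q), (j : ℕ) < t → p j = vertexJob S Nb j := by
    intro j hj
    funext k
    simp only [hp, vertexJob]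
    congr 1
    rw [eq_iff_iff]
    constructor
    · exact fun h => (Finset.mem_filter.1 (hUacc k j h hj)).2
    · intro h
      rw [hU, Finset.mem_attachFin]
      exact Finset.mem_union_left _ (Finset.mem_filter.2 ⟨Finset.mem_range.2 hj, h⟩)
  have hrun : ∀ j : Fin (t + q), (j : ℕ) < t → A.run (optTable M p) p j = col Nb j := by
    intro j hj
    simp only [OnlineAlgorithm.run, hcoldef, htable]
    rw [hpv j hj]
    congr 2
    funext l
    exact hpv _ (l.isLt.trans hj)
  -- the dimension of the monochromatic clique
  obtain ⟨k, hk⟩ : ∃ k, S k = Q i := by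
    have hlt : ∀ v ∈ Q i, v < M ^ 3 + 1 := fun v hv => (hpos.lt i v hv).trans_le ht
    set F := (Q i).attachFin hlt with hF
    have hFcard : F.card = q := by rw [hF, Finset.card_attachFin, hQ]
    obtain ⟨k, hk⟩ := he (F.orderEmbOfFin hFcard)
    refine ⟨k, ?_⟩
    ext v
    simp only [hS, hk, Finset.mem_image, Finset.mem_univ, true_and]
    constructor
    · rintro ⟨l, rfl⟩
      exact (Finset.mem_attachFin hlt).1 (F.orderEmbOfFin_mem hFcard l)
    · intro hv
      have h1 : (⟨v, hlt v hv⟩ : Fin (M ^ 3 + 1)) ∈ (F : Set (Fin (M ^ 3 + 1))) := by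
        simpa [hF] using hv
      rw [← F.range_orderEmbOfFin hFcard] at h1
      obtain ⟨l, hl⟩ := h1
      exact ⟨l, by rw [hl]⟩
  have hQacc : Q i = V k := by
    refine Finset.eq_of_subset_of_card_le (fun v hv => ?_) (by rw [hVcard, hQ])
    refine Finset.mem_union_left _ (Finset.mem_filter.2
      ⟨Finset.mem_range.2 (hpos.lt i v hv), hk ▸ hv, fun u hu huv => ?_⟩)
    rw [hk] at hu
    exact hpos.adj i u hu v hv huv
  refine ⟨t + q, p, G, k, hgood, fun r hr => ?_⟩
  refine le_trans (le_of_eq ?_) (le_lrNorm _ i hr)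
  rw [load_indicator, Finset.filter_true_of_mem, hUcard]
  intro j hj
  rw [hU, Finset.mem_attachFin, ← hQacc] at hj
  rw [hrun j (hpos.lt i j hj), hpos.color i j hj]

/-- The size of the clique that `d` dimensions allow: for `q` about `c * logRatio d`, the number of
sequences of `q` vertices is at most `q ^ (22 * q) ≤ d`. -/
theorem exists_le_logRatio_pow_le {d : ℕ} (hd : 3 ≤ d) {c : ℝ} (hc : 0 < c) (hc1 : c ≤ 1 / 22)
    (hc2 : c ≤ Real.log (Real.log 3)) (h : 2 ≤ c * logRatio d) :
    ∃ q : ℕ, 1 ≤ q ∧ c / 2 * logRatio d ≤ q ∧ ((16 * q ^ 3) ^ 3 + 1) ^ q ≤ d := by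
  have hlog := one_lt_log_natCast hd
  have hll : 0 < Real.log (Real.log d) := Real.log_pos hlog
  have hll3 : Real.log (Real.log 3) ≤ Real.log (Real.log d) := by
    have h1 : 1 < Real.log 3 := by simpa using one_lt_log_natCast le_rfl
    apply Real.log_le_log (by linarith)
    exact Real.log_le_log (by norm_num) (by exact_mod_cast hd)
  set q := ⌊c * logRatio d⌋₊ with hq
  have hq2 : 2 ≤ q := Nat.le_floor (by exact_mod_cast h)
  have hqle : (q : ℝ) ≤ c * logRatio d := Nat.floor_le (by linarith)
  have hqlt : c * logRatio d < q + 1 := Nat.lt_floor_add_one _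
  refine ⟨q, by lia, by linarith, ?_⟩
  have hbase : (16 * q ^ 3) ^ 3 + 1 ≤ q ^ 22 := by
    calc (16 * q ^ 3) ^ 3 + 1 = 2 ^ 12 * q ^ 9 + 1 := by ring
      _ ≤ q ^ 12 * q ^ 9 + 1 := by gcongr
      _ = q ^ 21 + 1 := by ring
      _ ≤ q ^ 21 * 2 := by linarith [Nat.one_le_pow 21 q (by lia)]
      _ ≤ q ^ 21 * q := by gcongr
      _ = q ^ 22 := by ring
  refine (Nat.pow_le_pow_left hbase q).trans ?_
  rw [← pow_mul]
  have hq0 : (0 : ℝ) < q := by positivity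
  have hρ : logRatio d * Real.log (Real.log d) = Real.log d := by
    rw [logRatio]; field_simp
  have hqlog : Real.log q ≤ Real.log (Real.log d) := by
    apply Real.log_le_log hq0
    have : 0 ≤ logRatio d := by linarith [one_le_logRatio hd]
    calc (q : ℝ) ≤ c * logRatio d := hqle
      _ ≤ Real.log (Real.log d) * logRatio d := by gcongr; linarith
      _ = Real.log d := by rw [mul_comm, hρ]
  have hfinal : ((22 * q : ℕ) : ℝ) * Real.log q ≤ Real.log d := by
    push_cast
    calc (22 * q : ℝ) * Real.log q ≤ 22 * (c * logRatio d) * Real.log (Real.log d) := by gcongr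
      _ = 22 * c * (logRatio d * Real.log (Real.log d)) := by ring
      _ = 22 * c * Real.log d := by rw [hρ]
      _ ≤ 1 * Real.log d := by gcongr; linarith
      _ = Real.log d := one_mul _
  rw [← Real.log_pow] at hfinal
  have := (Real.log_le_log_iff (by positivity) (by positivity)).1 hfinal
  exact_mod_cast this

/-- The lower bound for a single norm, with the constant `c / 2`. -/
theorem exists_instance_lower_bound {c : ℝ} (hc : 0 < c) (hc1 : c ≤ 1 / 22)
    (hc2 : c ≤ Real.log (Real.log 3)) {d : ℕ} (hd : 3 ≤ d) {r : ℝ} (hr : 1 ≤ r) :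
    ∃ m : ℕ, 1 ≤ m ∧ ∀ A : OnlineAlgorithm (Fin d → Set.Ici (1 : ℝ) → ℝ≥0) d m,
      ∃ (n : ℕ) (p : Fin n → Job d) (g : Fin n → Fin m) (k : Fin d), ∀ k' : Fin d,
        0 < lrNorm r (load p g k') ∧
        c / 2 * logRatio d ^ ((r - 1) / r) * (lrNorm r (load p g k') : ℝ) ≤
          (lrNorm r (load p (A.run (optTable m p) p) k) : ℝ) := by
  have hρ := one_le_logRatio hd
  have hr0 : r ≠ 0 := by linarith
  have hθ : 0 ≤ (r - 1) / r := div_nonneg (by linarith) (by linarith)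
  have hθ1 : (r - 1) / r ≤ 1 := by rw [div_le_one (by linarith)]; linarith
  -- a bound for `logRatio d` carries over to its power, as the constant is at most `1`
  have hpow : ∀ x : ℝ, c / 2 * logRatio d ≤ x →
      c / 2 * logRatio d ^ ((r - 1) / r) ≤ x ^ ((r - 1) / r) := by
    intro x hx
    calc c / 2 * logRatio d ^ ((r - 1) / r)
        ≤ (c / 2) ^ ((r - 1) / r) * logRatio d ^ ((r - 1) / r) := by
          gcongr
          calc c / 2 = (c / 2) ^ (1 : ℝ) := (Real.rpow_one _).symm
            _ ≤ _ := Real.rpow_le_rpow_of_exponent_ge (by positivity) (by linarith) hθ1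
      _ = (c / 2 * logRatio d) ^ ((r - 1) / r) := (Real.mul_rpow (by positivity) (by linarith)).symm
      _ ≤ x ^ ((r - 1) / r) := Real.rpow_le_rpow (by nlinarith) hx hθ
  rcases lt_or_ge (c * logRatio d) 2 with h | h
  · -- here the ratio is bounded by a constant and one job on one machine is enough
    refine ⟨1, le_rfl, fun A => ⟨1, fun _ _ => 1, fun _ => 0, ⟨0, by lia⟩, fun k' => ?_⟩⟩
    have h1 : ∀ (f : Fin 1 → Fin 1) (k : Fin d), lrNorm r (load (fun _ _ => 1) f k) = 1 := by
      intro f k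
      have hf : ∀ j, f j = 0 := fun j => Subsingleton.elim _ _
      simp [lrNorm, load, hf]
    rw [h1, h1]
    have := hpow 1 (by linarith)
    rw [Real.one_rpow] at this
    exact ⟨one_pos, by simpa using this⟩
  · obtain ⟨q, hq, hqρ, hqd⟩ := exists_le_logRatio_pow_le hd hc hc1 hc2 h
    have hq0 : (0 : ℝ≥0) < q := by positivity
    have hM : 1 ≤ 16 * q ^ 3 := Nat.succ_le_of_lt (by positivity)
    refine ⟨16 * q ^ 3, hM, fun A => ?_⟩
    obtain ⟨n, p, g, k, hg, hk⟩ := exists_instance_forcing_machine hq le_rfl hqd A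
    refine ⟨n, p, g, k, fun k' => ?_⟩
    rw [hg k' r hr]
    refine ⟨NNReal.rpow_pos hq0, ?_⟩
    calc c / 2 * logRatio d ^ ((r - 1) / r) * (((q : ℝ≥0) ^ (1 / r) : ℝ≥0) : ℝ)
        ≤ (q : ℝ) ^ ((r - 1) / r) * (q : ℝ) ^ (1 / r) := by
          rw [NNReal.coe_rpow, NNReal.coe_natCast]
          gcongr
          exact hpow q hqρ
      _ = (q : ℝ) := by
          rw [← Real.rpow_add (by positivity), ← add_div, sub_add_cancel, div_self hr0,
            Real.rpow_one]
      _ ≤ _ := by exact_mod_cast hk r hr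

end VectorScheduling

theorem mainTheorem3 :
    -- one algorithm, competitive for all norms and all dimensions at once
    (∃ C : ℝ, 0 < C ∧ ∀ d m : ℕ, 3 ≤ d → 1 ≤ m →
      ∃ A : VectorScheduling.OnlineAlgorithm (Fin d → ℝ≥0) d m,
        ∀ (n : ℕ) (p : Fin n → VectorScheduling.Job d) (k : Fin d) (r : ℝ), 1 ≤ r →
          (VectorScheduling.lrNorm r
              (VectorScheduling.load p (A.run (VectorScheduling.totalLoad p) p) k) : ℝ) ≤
            C * VectorScheduling.logRatio d ^ ((r - 1) / r) *
              (VectorScheduling.optNorm m p k r : ℝ)) ∧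
    -- the matching lower bound for every single norm, even against one offline assignment
    (∃ c : ℝ, 0 < c ∧ ∀ (d : ℕ) (r : ℝ), 3 ≤ d → 1 ≤ r →
      ∃ m : ℕ, 1 ≤ m ∧
        ∀ A : VectorScheduling.OnlineAlgorithm (Fin d → Set.Ici (1 : ℝ) → ℝ≥0) d m,
          ∃ (n : ℕ) (p : Fin n → VectorScheduling.Job d) (g : Fin n → Fin m) (k : Fin d),
            ∀ k' : Fin d,
              0 < VectorScheduling.lrNorm r (VectorScheduling.load p g k') ∧
              c * VectorScheduling.logRatio d ^ ((r - 1) / r) *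
                  (VectorScheduling.lrNorm r (VectorScheduling.load p g k') : ℝ) ≤
                (VectorScheduling.lrNorm r
                  (VectorScheduling.load p (A.run (VectorScheduling.optTable m p) p) k) : ℝ)) := by
  refine ⟨⟨32, by norm_num, fun d m hd hm => VectorScheduling.exists_online_le_optNorm hd hm⟩, ?_⟩
  have hll : 0 < Real.log (Real.log 3) :=
    Real.log_pos (by simpa using VectorScheduling.one_lt_log_natCast le_rfl)
  have hc : 0 < min (1 / 22) (Real.log (Real.log 3)) := lt_min (by norm_num) hll
  exact ⟨_, half_pos hc, fun d r hd hr =>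
    VectorScheduling.exists_instance_lower_bound hc (min_le_left _ _) (min_le_right _ _) hd hr⟩
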